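/- For every real $c>0$ there is a constant $K>0$, depending only on $c$, such that the following holds. Let $q$ be a prime power and let $\mathcal C\subseteq\mathbb F_q^n$ be a linear code of dimension $k$ and minimum distance $d$ with locality $r$, i.e. for every coordinate $i$ there is a set $R_i\subseteq\{1,\dots,n\}\setminus\{i\}$ with $|R_i|\le r$ such that any two codewords that agree on $R_i$ also agree at $i$. Assume that - $\mathcal C$ is Singleton-optimal, i.e. $d=n-k-\lceil k/r\rceil+2$; - $\mathcal C$ has disjoint recovery sets, i.e. $\{1,\dots,n\}$ has a partition into sets each of which is the support of a word of the dual code $\mathcal C^\perp$ and has size at most $r+1$; - $(r+1)\mid n$, $r<k$, $d\ge r+2$ and $n\ge c\,d\,r^2$. If $d\equiv 4t-i\pmod{r+1}$ for integers $t,i$ with $1\le t\le r/4$ and $i\in\{-1,0,1,2\}$, then $$n\le K\,q^{\,3-1/t}.$$ -/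

import Mathlib

namespace LRC

section

variable {F : Type*} [Field F] {n : ℕ}

/-- The support of a vector of `F^n`. -/
def supp [DecidableEq F] (c : Fin n → F) : Finset (Fin n) :=
  Finset.univ.filter fun i => c i ≠ 0

/-- The (Euclidean) dual code `C^⊥`. -/
def dualCode (C : Submodule F (Fin n → F)) : Submodule F (Fin n → F) where
  carrier := {c | ∀ u ∈ C, c ⬝ᵥ u = 0}
  add_mem' := fun {a b} ha hb u hu => by
    rw [add_dotProduct, ha u hu, hb u hu, add_zero]
  zero_mem' := fun u _ => zero_dotProduct u
  smul_mem' := fun x c hc u hu => by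
    rw [smul_dotProduct, hc u hu, smul_zero]

/-- `C` has minimum distance `d`: the smallest Hamming distance between two distinct codewords
exists and equals `d` (in particular `C` has at least two codewords). -/
def HasMinDist [DecidableEq F] (C : Submodule F (Fin n → F)) (d : ℕ) : Prop :=
  IsLeast {w : ℕ | ∃ u ∈ C, ∃ v ∈ C, u ≠ v ∧ hammingDist u v = w} d

/-- `C` has locality `r`: every coordinate `i` of a codeword is determined by at most `r` other
coordinates, at positions which depend on `i` only. -/
def HasLocality (C : Submodule F (Fin n → F)) (r : ℕ) : Prop :=
  ∀ i : Fin n, ∃ R : Finset (Fin n), i ∉ R ∧ R.card ≤ r ∧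
    ∀ u ∈ C, ∀ v ∈ C, (∀ j ∈ R, u j = v j) → u i = v i

/-- `C` is a linear `[n, k, d; r]` locally repairable code. -/
structure IsLRC [DecidableEq F] (C : Submodule F (Fin n → F)) (k d r : ℕ) : Prop where
  dim_eq : Module.finrank F C = k
  minDist : HasMinDist C d
  locality : HasLocality C r

/-- `C` is a Singleton-optimal `[n, k, d; r]` locally repairable code: it attains equality in the
Singleton-type bound `d ≤ n - k - ⌈k / r⌉ + 2`. -/
structure IsSingletonOptimal [DecidableEq F] (C : Submodule F (Fin n → F)) (k d r : ℕ) : Prop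
    extends IsLRC C k d r where
  singleton_eq : (d : ℤ) = (n : ℤ) - (k : ℤ) - ⌈(k : ℚ) / (r : ℚ)⌉ + 2

/-- The set of all supports of size at most `r + 1` of words of the dual code. -/
def recoverySupports [DecidableEq F] (C : Submodule F (Fin n → F)) (r : ℕ) :
    Set (Finset (Fin n)) :=
  {I | ∃ c ∈ dualCode C, supp c = I ∧ I.card ≤ r + 1}

/-- `C` has disjoint recovery sets (for locality `r`): some members of `recoverySupports C r` form
a partition of the set of all coordinates. -/
def HasDisjointRecoverySets [DecidableEq F] (C : Submodule F (Fin n → F)) (r : ℕ) : Prop :=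
  ∃ P : Finpartition (Finset.univ : Finset (Fin n)), ∀ I ∈ P.parts, I ∈ recoverySupports C r

end

end LRC

namespace LRC

/-! ### Subcodes with prescribed zeros, and what optimality forces. -/

section

variable {F : Type*} [Field F] {n : ℕ}

/-! Put `j = ⌈k/r⌉`, so that `d + k + j = n + 2` and `n ≤ d + j(r+1)`; it remains to bound `d` and
`j(r+1)`. Prescribing zeros on whole recovery sets saves one dimension per set, and a
two-dimensional subcode then gives `d ≤ 2q` (`minDist_le_two_mul_card`).

If `j ≥ r`, all recovery sets have size exactly `r + 1` (`card_part_eq`). Fix `j` of them and work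
in the space cut out by their `j` parity checks. Sums of `t` words of weight two, one from each of
`t` disjoint groups of these sets, pairwise differ in at most `4t` places. A set `B` of `d - 1 - 4t`
coordinates off the `j` sets may be filled freely, so the translates are still distinct modulo `C`
(`card_mul_le_pow`). With `N` choices per group, counting gives `N^t ≤ q^(4t-1)`
(`card_pairIndex_pow_le`). As `N` is at least `j(r+1)q/2`, this yields `j(r+1) ≤ 2q^(3-1/t)`. The
congruence on `d` is what leaves room for `B` (`exists_ceil_eq`).

If `j < r`, the hypothesis `n ≥ c d r²` bounds `r`, hence `j(r+1)`, in terms of `c` alone. -/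

/-- The words of `C` vanishing on `A`. -/
def vanishing (C : Submodule F (Fin n → F)) (A : Finset (Fin n)) : Submodule F (Fin n → F) where
  carrier := {c | c ∈ C ∧ ∀ z ∈ A, c z = 0}
  add_mem' := fun {a b} ha hb => ⟨C.add_mem ha.1 hb.1, fun z hz => by
    simp [ha.2 z hz, hb.2 z hz]⟩
  zero_mem' := ⟨C.zero_mem, fun _ _ => rfl⟩
  smul_mem' := fun x c hc => ⟨C.smul_mem x hc.1, fun z hz => by simp [hc.2 z hz]⟩

lemma finrank_le_vanishing_add_card (C : Submodule F (Fin n → F)) (A : Finset (Fin n)) :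
    Module.finrank F C ≤ Module.finrank F (vanishing C A) + A.card := by
  let f : C →ₗ[F] (A → F) := (LinearMap.funLeft F F (fun z : A => (z : Fin n))) ∘ₗ C.subtype
  have h1 := f.finrank_range_add_finrank_ker
  have h2 : Module.finrank F (LinearMap.range f) ≤ A.card := by
    simpa using (LinearMap.range f).finrank_le
  have h3 : Module.finrank F (LinearMap.ker f) ≤ Module.finrank F (vanishing C A) := by
    let g : LinearMap.ker f →ₗ[F] vanishing C A :=
      { toFun := fun c => ⟨c.1.1, c.1.2, fun z hz => congrFun c.2 ⟨z, hz⟩⟩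
        map_add' := fun _ _ => rfl
        map_smul' := fun _ _ => rfl }
    refine LinearMap.finrank_le_finrank_of_injective (f := g) fun a b hab => ?_
    have h : (g a : Fin n → F) = g b := by rw [hab]
    exact Subtype.ext (Subtype.ext h)
  omega

variable [DecidableEq F]

lemma HasMinDist.le_hammingNorm {C : Submodule F (Fin n → F)} {d : ℕ} (h : HasMinDist C d)
    {c : Fin n → F} (hc : c ∈ C) (h0 : c ≠ 0) : d ≤ hammingNorm c :=
  h.2 ⟨c, hc, 0, C.zero_mem, h0, hammingDist_zero_right c⟩

lemma hammingNorm_add_card_le {c : Fin n → F} {A : Finset (Fin n)} (h : ∀ z ∈ A, c z = 0) :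
    hammingNorm c + A.card ≤ n := by
  have h1 : Disjoint (Finset.univ.filter fun i => c i ≠ 0) A := by
    rw [Finset.disjoint_left]
    intro z hz hA
    exact (Finset.mem_filter.1 hz).2 (h z hA)
  have h2 := Finset.card_le_univ ((Finset.univ.filter fun i => c i ≠ 0) ∪ A)
  rw [Finset.card_union_of_disjoint h1, Fintype.card_fin] at h2
  exact h2

/-- Words vanishing on all but one position of a recovery set vanish on all of it, so that many
zeros can be prescribed at the cost of few dimensions. -/
lemma exists_vanishing_finrank {C : Submodule F (Fin n → F)} {r : ℕ}
    {P : Finpartition (Finset.univ : Finset (Fin n))}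
    (hP : ∀ I ∈ P.parts, I ∈ recoverySupports C r) {J : Finset (Finset (Fin n))}
    (hJ : J ⊆ P.parts) {T : ℕ} (hT : ∑ I ∈ J, I.card ≤ T + J.card) (hn : T + J.card ≤ n) :
    ∃ A : Finset (Fin n), A.card = T + J.card ∧
      Module.finrank F C ≤ Module.finrank F (vanishing C A) + T := by
  classical
  have hdisj : (J : Set (Finset (Fin n))).PairwiseDisjoint id :=
    P.disjoint.subset hJ
  have hcard : (J.biUnion id).card = ∑ I ∈ J, I.card := Finset.card_biUnion hdisj
  obtain ⟨A, hA, -, hAc⟩ := Finset.exists_subsuperset_card_eq (Finset.subset_univ (J.biUnion id))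
    (hcard.trans_le hT) (by simpa using hn)
  have hne : ∀ I : J, (I : Finset (Fin n)).Nonempty := fun I => P.nonempty_of_mem_parts (hJ I.2)
  choose ρ hρ using hne
  have hρA : ∀ I : J, ρ I ∈ A := fun I =>
    hA (Finset.mem_biUnion.2 ⟨I, I.2, hρ I⟩)
  have hρinj : Function.Injective ρ := by
    intro I I' h
    by_contra hne
    have := hdisj I.2 I'.2 (fun h => hne (Subtype.ext h))
    exact Finset.disjoint_left.1 this (hρ I) (h ▸ hρ I')
  let R := Finset.univ.image ρ
  have hR : R.card = J.card := by
    rw [Finset.card_image_of_injective _ hρinj]; simp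
  have hRA : R ⊆ A := by
    intro z hz
    obtain ⟨I, -, rfl⟩ := Finset.mem_image.1 hz
    exact hρA I
  refine ⟨A, hAc, ?_⟩
  have h1 := finrank_le_vanishing_add_card C (A \ R)
  have h2 : (A \ R).card = T := by
    rw [Finset.card_sdiff_of_subset hRA]; omega
  have h3 : vanishing C (A \ R) ≤ vanishing C A := by
    rintro c ⟨hc, hz⟩
    refine ⟨hc, fun z hzA => ?_⟩
    by_cases hzR : z ∈ R
    · obtain ⟨I, -, rfl⟩ := Finset.mem_image.1 hzR
      obtain ⟨w, hw, hsupp, -⟩ := hP I (hJ I.2)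
      have hdot := hw c hc
      have hmem : ∀ z, w z ≠ 0 ↔ z ∈ (I : Finset (Fin n)) := by
        intro z; rw [← hsupp]; simp [supp]
      rw [dotProduct, Finset.sum_eq_single (ρ I)] at hdot
      · exact (mul_eq_zero.1 hdot).resolve_left ((hmem _).2 (hρ I))
      · intro y _ hy
        by_cases hyI : y ∈ (I : Finset (Fin n))
        · rw [hz y, mul_zero]
          refine Finset.mem_sdiff.2 ⟨hA (Finset.mem_biUnion.2 ⟨I, I.2, hyI⟩), fun hyR => ?_⟩
          obtain ⟨I', -, rfl⟩ := Finset.mem_image.1 hyR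
          have : I ≠ I' := fun h => hy (by rw [h])
          exact Finset.disjoint_left.1 (hdisj I.2 I'.2 (fun h => this (Subtype.ext h))) hyI (hρ I')
        · rw [not_not.1 (mt (hmem y).1 hyI), zero_mul]
      · simp
    · exact hz z (Finset.mem_sdiff.2 ⟨hzA, hzR⟩)
  have h4 := Submodule.finrank_mono h3
  omega

lemma minDist_add_card_le {C : Submodule F (Fin n → F)} {d : ℕ} (h : HasMinDist C d)
    {A : Finset (Fin n)} (hA : 0 < Module.finrank F (vanishing C A)) : d + A.card ≤ n := by
  have := Module.nontrivial_of_finrank_pos hA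
  obtain ⟨⟨c, hc⟩, h0⟩ := exists_ne (0 : vanishing C A)
  have h1 := h.le_hammingNorm hc.1 (fun h => h0 (Subtype.ext h))
  have h2 := hammingNorm_add_card_le hc.2
  omega

/-- A two-dimensional code of length `n - |A|` and minimum distance `d` over `F_q` satisfies
`d ≤ q (n - |A| - d)`. -/
lemma minDist_le_mul_card [Fintype F] {C : Submodule F (Fin n → F)} {d s : ℕ}
    (h : HasMinDist C d) {A : Finset (Fin n)} (hA : 2 ≤ Module.finrank F (vanishing C A))
    (hs : n ≤ A.card + d + s) : d ≤ s * Fintype.card F := by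
  obtain ⟨y, hy⟩ := Module.finrank_pos_iff_exists_ne_zero.1
    (show 0 < Module.finrank F (vanishing C A) by omega)
  obtain ⟨x, hx⟩ : ∃ x : vanishing C A, ∀ α : F, x + α • y ≠ 0 := by
    by_contra! hcon
    have : Module.finrank F (vanishing C A) ≤ 1 := finrank_le_one y fun w => by
      obtain ⟨α, hα⟩ := hcon w
      exact ⟨-α, by rw [neg_smul]; exact (eq_neg_of_add_eq_zero_left hα).symm⟩
    omega
  obtain ⟨x, hxA⟩ := x
  obtain ⟨y, hyA⟩ := y
  let S := Finset.univ.filter fun z => y z ≠ 0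
  have hS : d ≤ S.card := h.le_hammingNorm hyA.1 fun h => hy (Subtype.ext h)
  -- The fibre over `α` consists of zeros of `x + α y` outside `A`, so it has at most `s` elements.
  have h1 : S.card ≤ s * (Finset.univ : Finset F).card := by
    refine Finset.card_le_mul_card_image_of_maps_to (f := fun z => -(x z / y z))
      (fun _ _ => Finset.mem_univ _) s fun α _ => ?_
    have h2 : ∀ z ∈ A ∪ S.filter (fun z => -(x z / y z) = α), (x + α • y) z = 0 := by
      intro z hz
      rcases Finset.mem_union.1 hz with hz | hz
      · simp [hxA.2 z hz, hyA.2 z hz]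
      · obtain ⟨hz1, hz2⟩ := Finset.mem_filter.1 hz
        have hz3 : y z ≠ 0 := (Finset.mem_filter.1 hz1).2
        simp only [Pi.add_apply, Pi.smul_apply, smul_eq_mul, ← hz2]
        field_simp
        ring
    have h3 := hammingNorm_add_card_le h2
    have h4 := h.le_hammingNorm (C.add_mem hxA.1 (C.smul_mem α hyA.1))
      (fun h => hx α (Subtype.ext h))
    rw [Finset.card_union_of_disjoint] at h3
    · omega
    · rw [Finset.disjoint_left]
      intro z hzA hz
      exact (Finset.mem_filter.1 (Finset.mem_filter.1 hz).1).2 (hyA.2 z hzA)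
  rw [Finset.card_univ] at h1
  omega

lemma sum_card_parts (P : Finpartition (Finset.univ : Finset (Fin n))) :
    ∑ I ∈ P.parts, I.card = n := by
  simpa using P.sum_card_parts

lemma card_le_parts_mul {C : Submodule F (Fin n → F)} {r : ℕ}
    {P : Finpartition (Finset.univ : Finset (Fin n))}
    (hP : ∀ I ∈ P.parts, I ∈ recoverySupports C r) : n ≤ P.parts.card * (r + 1) := by
  have h := Finset.sum_le_card_nsmul P.parts Finset.card (r + 1)
    (fun I hI => by obtain ⟨_, _, _, h⟩ := hP I hI; exact h)
  rwa [sum_card_parts, smul_eq_mul] at h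

lemma sum_card_le_mul {C : Submodule F (Fin n → F)} {r : ℕ}
    {P : Finpartition (Finset.univ : Finset (Fin n))}
    (hP : ∀ I ∈ P.parts, I ∈ recoverySupports C r) {J : Finset (Finset (Fin n))}
    (hJ : J ⊆ P.parts) : ∑ I ∈ J, I.card ≤ J.card * (r + 1) := by
  have h := Finset.sum_le_card_nsmul J Finset.card (r + 1)
    (fun I hI => by obtain ⟨_, _, _, h⟩ := hP I (hJ hI); exact h)
  rwa [smul_eq_mul] at h

/-- Zeros on `j - 2` recovery sets, padded to `k + j - 4 = n - d - 2` positions, cost only `k - 2`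
dimensions and leave a two-dimensional subcode. -/
lemma minDist_le_two_mul_card [Fintype F] {C : Submodule F (Fin n → F)} {k d r j : ℕ}
    (hk : Module.finrank F C = k) (hd : HasMinDist C d)
    {P : Finpartition (Finset.univ : Finset (Fin n))}
    (hP : ∀ I ∈ P.parts, I ∈ recoverySupports C r)
    (hj : d + k + j = n + 2) (hjk : r * j < k + r) (hr : 2 ≤ r) (hj2 : 2 ≤ j) (hk2 : 2 ≤ k)
    (hjl : j ≤ P.parts.card) :
    d ≤ 2 * Fintype.card F := by
  obtain ⟨J, hJ, hJc⟩ := Finset.exists_subset_card_eq (show j - 2 ≤ P.parts.card by omega)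
  have hsum := sum_card_le_mul hP hJ
  obtain ⟨j, rfl⟩ := Nat.exists_eq_add_of_le' hj2
  obtain ⟨k, rfl⟩ := Nat.exists_eq_add_of_le' hk2
  have hjk' : r * j ≤ k := by nlinarith
  have hJc' : J.card = j := hJc
  obtain ⟨A, hA, hA2⟩ := exists_vanishing_finrank hP hJ (T := k)
    (by rw [hJc'] at hsum ⊢; nlinarith) (by omega)
  exact minDist_le_mul_card hd (A := A) (by omega) (by omega)

/-- If the number of disjoint recovery sets that determine the code is at least `r`, then optimality
forces all recovery sets to have size `r + 1`. -/
lemma card_part_eq {C : Submodule F (Fin n → F)} {k d r j : ℕ}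
    (hk : Module.finrank F C = k) (hd : HasMinDist C d)
    {P : Finpartition (Finset.univ : Finset (Fin n))}
    (hP : ∀ I ∈ P.parts, I ∈ recoverySupports C r) (hn : (r + 1) ∣ n)
    (hj : d + k + j = n + 2) (hjk : r * j < k + r) (hrj : r ≤ j) (hk1 : 1 ≤ k) (hd1 : 1 ≤ d)
    (hjl : j ≤ P.parts.card) :
    ∀ I ∈ P.parts, I.card = r + 1 := by
  classical
  have hle : ∀ I ∈ P.parts, I.card ≤ r + 1 := fun I hI => by
    obtain ⟨_, _, _, h⟩ := hP I hI; exact h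
  suffices hl : P.parts.card * (r + 1) ≤ n by
    have h1 : ∑ I ∈ P.parts, I.card = ∑ I ∈ P.parts, (r + 1) := by
      rw [Finset.sum_const, smul_eq_mul, sum_card_parts]
      exact le_antisymm (card_le_parts_mul hP) hl
    exact (Finset.sum_eq_sum_iff_of_le hle).1 h1
  by_contra! hlt
  obtain ⟨m, rfl⟩ := hn
  have hlm : m + 1 ≤ P.parts.card := by
    by_contra! h
    nlinarith
  -- A part too many makes the total deficiency at least `r + 1`. Either `j ≥ r` deficient sets can
  -- be taken, or all of them fit into `J`; both ways `J` misses at least `r` points.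
  obtain ⟨J, hJ, hJc, hJs⟩ : ∃ J ⊆ P.parts, J.card = j ∧ ∑ I ∈ J, I.card + r ≤ j * (r + 1) := by
    let D := P.parts.filter fun I => I.card ≤ r
    rcases le_total j D.card with hjD | hjD
    · obtain ⟨J, hJ, hJc⟩ := Finset.exists_subset_card_eq hjD
      refine ⟨J, hJ.trans (Finset.filter_subset _ _), hJc, ?_⟩
      have := Finset.sum_le_card_nsmul J Finset.card r fun I hI => (Finset.mem_filter.1 (hJ hI)).2
      rw [hJc, smul_eq_mul] at this
      nlinarith
    · obtain ⟨J, hDJ, hJ, hJc⟩ := Finset.exists_subsuperset_card_eq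
        (Finset.filter_subset (fun I : Finset (Fin _) => I.card ≤ r) P.parts) hjD hjl
      refine ⟨J, hJ, hJc, ?_⟩
      have h1 := Finset.sum_sdiff (f := Finset.card) hJ
      have h2 : ∑ I ∈ P.parts \ J, I.card = ∑ I ∈ P.parts \ J, (r + 1) := by
        refine Finset.sum_congr rfl fun I hI => ?_
        obtain ⟨hI1, hI2⟩ := Finset.mem_sdiff.1 hI
        refine le_antisymm (hle I hI1) ?_
        by_contra! h
        exact hI2 (hDJ (Finset.mem_filter.2 ⟨hI1, by omega⟩))
      rw [Finset.sum_const, smul_eq_mul, Finset.card_sdiff_of_subset hJ, hJc] at h2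
      rw [sum_card_parts, h2] at h1
      obtain ⟨l, hl⟩ := Nat.exists_eq_add_of_le hjl
      rw [hl] at h1 hlm
      rw [Nat.add_sub_cancel_left] at h1
      nlinarith
  obtain ⟨k, rfl⟩ := Nat.exists_eq_add_of_le' hk1
  -- After the shift of `k` by one, a nonzero codeword with `k + j` zeros survives, one more than
  -- the distance allows.
  obtain ⟨A, hA, hA2⟩ := exists_vanishing_finrank hP hJ (T := k)
    (by rw [hJc]; nlinarith) (by omega)
  have := minDist_add_card_le hd (A := A) (by omega)
  omega

end

/-! ### Sphere packing under local parity checks. -/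

section

variable {F : Type*} [Field F] {n : ℕ}

/-- Each check has a private coordinate `ρ i`, so its value can be set independently; hence the
checks cut out codimension exactly `|J|`. -/
lemma pairing_surjective {J : Type*} [Fintype J] {w : J → Fin n → F} {ρ : J → Fin n}
    (hρ : ∀ i i', w i (ρ i') ≠ 0 ↔ i = i') :
    Function.Surjective (Matrix.mulVecLin (Matrix.of w)) := by
  classical
  intro y
  refine ⟨∑ i, Pi.single (ρ i) (y i / w i (ρ i)), ?_⟩
  rw [map_sum]
  ext i
  rw [Finset.sum_apply, Finset.sum_eq_single i]
  · have h := mul_div_cancel₀ (y i) ((hρ i i).2 rfl)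
    rw [div_eq_mul_inv] at h
    simp only [Matrix.mulVecLin_apply, Matrix.mulVec_single, Pi.smul_apply, Matrix.col_apply,
      Matrix.of_apply, op_smul_eq_smul, smul_eq_mul, div_eq_mul_inv]
    linear_combination h
  · intro i' _ hi
    have : w i (ρ i') = 0 := not_not.1 (mt (hρ i i').1 (Ne.symm hi))
    simp [this]
  · simp

variable [DecidableEq F]

lemma hammingNorm_add_le {x y : Fin n → F} :
    hammingNorm (x + y) ≤ hammingNorm x + hammingNorm y := by
  refine (Finset.card_le_card fun z hz => ?_).trans (Finset.card_union_le _ _)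
  by_contra h
  simp only [Finset.mem_union, Finset.mem_filter, Finset.mem_univ, true_and, not_or, not_not] at h
  exact (Finset.mem_filter.1 hz).2 (by rw [Pi.add_apply, h.1, h.2, add_zero])

/-- Sphere packing modulo the words supported on a set `B` of coordinates, inside the space of words
that satisfy `j` local parity checks. -/
lemma card_mul_le_pow [Fintype F] {C : Submodule F (Fin n → F)} {d : ℕ} (hd : HasMinDist C d)
    {J : Type*} [Fintype J] {w : J → Fin n → F} {ρ : J → Fin n}
    (hρ : ∀ i i', w i (ρ i') ≠ 0 ↔ i = i') (hw : ∀ i, w i ∈ dualCode C)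
    {B : Finset (Fin n)} (hB : ∀ i, ∀ z ∈ B, w i z = 0)
    {ι : Type*} [Fintype ι] {v : ι → Fin n → F} (hv : Function.Injective v)
    (hvw : ∀ a i, w i ⬝ᵥ v a = 0) (hvB : ∀ a, ∀ z ∈ B, v a z = 0) {s : ℕ}
    (hvs : ∀ a a', hammingNorm (v a - v a') ≤ s) (hs : s + B.card < d) :
    Fintype.card ι * Fintype.card F ^ (Module.finrank F C + B.card + Fintype.card J) ≤
      Fintype.card F ^ n := by
  classical
  let L := LinearMap.ker (Matrix.mulVecLin (Matrix.of w))
  have hL : Module.finrank F L + Fintype.card J = n := by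
    have h := (Matrix.mulVecLin (Matrix.of w)).finrank_range_add_finrank_ker
    rw [LinearMap.range_eq_top.2 (pairing_surjective hρ), finrank_top] at h
    simp only [Module.finrank_fintype_fun_eq_card, Fintype.card_fin] at h
    rw [add_comm]; exact h
  let ext : (B → F) → Fin n → F := fun b z => if h : z ∈ B then b ⟨z, h⟩ else 0
  have hext0 : ∀ b, ∀ z ∉ B, ext b z = 0 := fun b z hz => dif_neg hz
  have hext1 : ∀ b, ∀ z : B, ext b z = b z := fun b z => dif_pos z.2
  have hmem : ∀ x : ι × C × (B → F), v x.1 + x.2.1 + ext x.2.2 ∈ L := by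
    rintro ⟨a, c, b⟩
    rw [LinearMap.mem_ker]
    ext i
    have h1 : w i ⬝ᵥ (c : Fin n → F) = 0 := hw i c c.2
    have h2 : w i ⬝ᵥ ext b = 0 := Finset.sum_eq_zero fun z _ => by
      by_cases hz : z ∈ B
      · rw [hB i z hz, zero_mul]
      · rw [hext0 b z hz, mul_zero]
    have h3 : w i ⬝ᵥ (v a + c + ext b) = 0 := by
      rw [dotProduct_add, dotProduct_add, hvw, h1, h2, add_zero, add_zero]
    exact h3
  let Φ : ι × C × (B → F) → L := fun x => ⟨_, hmem x⟩
  have hΦ : Function.Injective Φ := by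
    rintro ⟨a, c, b⟩ ⟨a', c', b'⟩ h
    have h1 : v a + c + ext b = v a' + c' + ext b' := congrArg Subtype.val h
    -- Otherwise `c - c'` would be a nonzero codeword of weight at most `s + |B| < d`.
    have hc : c = c' := by
      by_contra hne
      have h2 : ((c - c' : C) : Fin n → F) = -(v a - v a') + -(ext b - ext b') := by
        rw [Submodule.coe_sub]
        linear_combination h1
      have h3 := hd.le_hammingNorm (c - c').2
        (fun h => hne (sub_eq_zero.1 (Subtype.ext h)))
      have h5 := hvs a' a
      have h7 : hammingNorm (ext b' - ext b) ≤ B.card := by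
        refine Finset.card_le_card fun z hz => ?_
        by_contra hzB
        exact (Finset.mem_filter.1 hz).2 (by simp [hext0 _ z hzB])
      rw [h2, neg_sub, neg_sub] at h3
      have := hammingNorm_add_le (x := v a' - v a) (y := ext b' - ext b)
      omega
    subst hc
    have h2 : v a + ext b = v a' + ext b' := by linear_combination h1
    have ha : v a = v a' := by
      ext z
      by_cases hz : z ∈ B
      · rw [hvB a z hz, hvB a' z hz]
      · simpa [hext0 _ z hz] using congrFun h2 z
    have hb : b = b' := by
      ext z
      have := congrFun h2 z
      rwa [Pi.add_apply, Pi.add_apply, ha, add_right_inj, hext1, hext1] at this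
    rw [hv ha, hb]
  have h := Nat.card_le_card_of_injective Φ hΦ
  rw [Nat.card_prod, Nat.card_prod, Module.natCard_eq_pow_finrank (K := F) (V := L),
    Module.natCard_eq_pow_finrank (K := F) (V := C), Nat.card_fun] at h
  simp only [Nat.card_eq_fintype_card, Fintype.card_coe] at h
  calc _ = Fintype.card ι * (Fintype.card F ^ Module.finrank F C * Fintype.card F ^ B.card) *
        Fintype.card F ^ Fintype.card J := by ring
    _ ≤ Fintype.card F ^ Module.finrank F L * Fintype.card F ^ Fintype.card J :=
        Nat.mul_le_mul_right _ h
    _ = _ := by rw [← pow_add, hL]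

end

/-! ### Words of weight two with coordinate sum zero. -/

section

variable {F : Type*} [Field F]

/-- The index set of the words of weight two and coordinate sum zero, supported in one of `g`
blocks of size `r + 1`. -/
abbrev PairIndex (F : Type*) [Field F] (g r : ℕ) : Type _ :=
  Fin g × (Σ b : Fin (r + 1), Fin b) × Fˣ

/-- The word of weight two with index `p`. -/
def pairWord {g r : ℕ} (p : PairIndex F g r) (y : Fin g) (s : Fin (r + 1)) : F :=
  if y = p.1 then
    if s = p.2.1.1 then p.2.2 else if s = p.2.1.2.castLE p.2.1.1.2.le then -p.2.2 else 0
  else 0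

lemma card_pairIndex [Fintype F] [DecidableEq F] (g r : ℕ) :
    2 * Fintype.card (PairIndex F g r) = g * (r * (r + 1)) * (Fintype.card F - 1) := by
  have h := Finset.sum_range_id_mul_two (r + 1)
  rw [← Fin.sum_univ_eq_sum_range (fun i => i)] at h
  simp only [Fintype.card_prod, Fintype.card_fin, Fintype.card_sigma, Fintype.card_units]
  rw [Nat.add_sub_cancel] at h
  calc _ = g * ((∑ i : Fin (r + 1), (i : ℕ)) * 2) * (Fintype.card F - 1) := by ring
    _ = _ := by rw [h]; ring

lemma pairWord_sum {g r : ℕ} (p : PairIndex F g r) (y : Fin g) : ∑ s, pairWord p y s = 0 := by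
  obtain ⟨v, ⟨b, a⟩, l⟩ := p
  by_cases hy : y = v
  · have hab : a.castLE b.2.le ≠ b := fun h => by
      have := a.2
      have h' := congrArg Fin.val h
      simp at h'
      omega
    rw [Finset.sum_eq_add_of_mem b (a.castLE b.2.le) (Finset.mem_univ _) (Finset.mem_univ _)
      hab.symm]
    · simp [pairWord, hy, hab]
    · rintro s - ⟨h1, h2⟩
      simp [pairWord, h1, h2]
  · simp [pairWord, hy]

lemma pairWord_ne_zero {g r : ℕ} (p : PairIndex F g r) (y : Fin g) (s : Fin (r + 1)) :
    pairWord p y s ≠ 0 ↔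
      y = p.1 ∧ (s = p.2.1.1 ∨ s = p.2.1.2.castLE p.2.1.1.2.le) := by
  unfold pairWord
  split_ifs <;> simp_all

lemma pairWord_injective (g r : ℕ) :
    Function.Injective (pairWord : PairIndex F g r → Fin g → Fin (r + 1) → F) := by
  rintro ⟨v, ⟨b, a⟩, l⟩ ⟨v', ⟨b', a'⟩, l'⟩ h
  have key : ∀ y s, (y = v ∧ (s = b ∨ s = a.castLE b.2.le)) ↔
      (y = v' ∧ (s = b' ∨ s = a'.castLE b'.2.le)) := fun y s => by
    rw [← pairWord_ne_zero ⟨v, ⟨b, a⟩, l⟩, h, pairWord_ne_zero]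
  have hv : v = v' := ((key v b).1 ⟨rfl, Or.inl rfl⟩).1
  subst hv
  have h1 := (key v b).1 ⟨rfl, Or.inl rfl⟩
  have h2 := (key v (a.castLE b.2.le)).1 ⟨rfl, Or.inr rfl⟩
  have h3 := (key v b').2 ⟨rfl, Or.inl rfl⟩
  have h4 := (key v (a'.castLE b'.2.le)).2 ⟨rfl, Or.inr rfl⟩
  have ha := a.2
  have ha' := a'.2
  simp only [true_and, Fin.ext_iff, Fin.val_castLE] at h1 h2 h3 h4
  have hb : b = b' := Fin.ext (by omega)
  subst hb
  have haa : a = a' := Fin.ext (by omega)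
  subst haa
  have h5 := congrFun (congrFun h v) b
  simp only [pairWord, if_true] at h5
  rw [Units.ext h5]

lemma hammingNorm_pairWord_family_le [DecidableEq F] {t g r : ℕ} (f f' : Fin t → PairIndex F g r) :
    (Finset.univ.filter fun x : (Fin t × Fin g) × Fin (r + 1) =>
      pairWord (f x.1.1) x.1.2 x.2 - pairWord (f' x.1.1) x.1.2 x.2 ≠ 0).card ≤ 4 * t := by
  let pt : PairIndex F g r → Finset (Fin g × Fin (r + 1)) := fun p =>
    {(p.1, p.2.1.1), (p.1, p.2.1.2.castLE p.2.1.1.2.le)}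
  have hpt : ∀ p, (pt p).card ≤ 2 := fun p => Finset.card_le_two
  let S : Finset ((Fin t × Fin g) × Fin (r + 1)) := Finset.univ.biUnion fun u =>
    (pt (f u) ∪ pt (f' u)).image fun y => ((u, y.1), y.2)
  have hS : S.card ≤ (Finset.univ : Finset (Fin t)).card * 4 :=
    Finset.card_biUnion_le_card_mul _ _ _ fun u _ => Finset.card_image_le.trans
      ((Finset.card_union_le _ _).trans (add_le_add (hpt _) (hpt _)))
  rw [Finset.card_univ, Fintype.card_fin, mul_comm] at hS
  refine (Finset.card_le_card fun x hx => ?_).trans hS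
  obtain ⟨⟨u, y⟩, s⟩ := x
  have hx' : pairWord (f u) y s - pairWord (f' u) y s ≠ 0 := (Finset.mem_filter.1 hx).2
  refine Finset.mem_biUnion.2 ⟨u, Finset.mem_univ _, Finset.mem_image.2 ⟨(y, s), ?_, rfl⟩⟩
  by_cases h : pairWord (f u) y s ≠ 0
  · have := (pairWord_ne_zero _ _ _).1 h
    refine Finset.mem_union_left _ ?_
    simp only [pt, Finset.mem_insert, Finset.mem_singleton, Prod.mk.injEq]
    tauto
  · have h' : pairWord (f' u) y s ≠ 0 := fun h0 => hx' (by rw [not_not.1 h, h0, sub_zero])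
    have := (pairWord_ne_zero _ _ _).1 h'
    refine Finset.mem_union_right _ ?_
    simp only [pt, Finset.mem_insert, Finset.mem_singleton, Prod.mk.injEq]
    tauto

end

/-! ### The packing bound for optimal codes. -/

section

variable {F : Type*} [Field F] [DecidableEq F] {n : ℕ}

/-- The packing bound for a code with `j` disjoint recovery sets of size `r + 1`, applied to sums of
`t` words of weight two that are taken from `t` disjoint groups of `g` recovery sets each. -/
lemma card_pairIndex_pow_le [Fintype F] {C : Submodule F (Fin n → F)} {k d r j t g : ℕ}
    (hk : Module.finrank F C = k) (hd : HasMinDist C d) (hj : d + k + j = n + 2)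
    {w : Fin j → Fin n → F} (hw : ∀ i, w i ∈ dualCode C) {pos : Fin j → Fin (r + 1) → Fin n}
    (hpos : ∀ i z, w i z ≠ 0 ↔ ∃ s, pos i s = z)
    (hinj : ∀ i s i' s', pos i s = pos i' s' → i = i' ∧ s = s')
    (ht : 1 ≤ t) (htd : 4 * t + 1 ≤ d) (hjk : r * j + 1 ≤ k + 4 * t) (htg : t * g ≤ j) :
    Fintype.card (PairIndex F g r) ^ t * Fintype.card F ≤ Fintype.card F ^ (4 * t) := by
  -- Disjoint groups let the sum determine its summands in order, so no factor `t!` is lost.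
  let φ : Fin t × Fin g → Fin j := fun u => (finProdFinEquiv u).castLE htg
  have hφ : Function.Injective φ := (Fin.castLE_injective htg).comp finProdFinEquiv.injective
  let p : (Fin t × Fin g) × Fin (r + 1) → Fin n := fun x => pos (φ x.1) x.2
  have hp : Function.Injective p := by
    rintro ⟨u, s⟩ ⟨u', s'⟩ h
    obtain ⟨h1, h2⟩ := hinj _ _ _ _ h
    exact Prod.ext (hφ h1) h2
  have hwp : ∀ x, w (φ x.1) (p x) ≠ 0 := fun x => (hpos _ _).2 ⟨x.2, rfl⟩
  have hwp' : ∀ i x, i ≠ φ x.1 → w i (p x) = 0 := by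
    intro i x hi
    by_contra h
    obtain ⟨s, hs⟩ := (hpos _ _).1 h
    exact hi (hinj _ _ _ _ hs).1
  -- Dividing by the entries of the check turns coordinate sum zero into orthogonality to it.
  let v : (Fin t → PairIndex F g r) → Fin n → F := fun f =>
    Function.extend p (fun x => pairWord (f x.1.1) x.1.2 x.2 / w (φ x.1) (p x)) 0
  have hv1 : ∀ f x, v f (p x) = pairWord (f x.1.1) x.1.2 x.2 / w (φ x.1) (p x) :=
    fun f x => hp.extend_apply _ _ x
  have hv0 : ∀ f z, (¬ ∃ x, p x = z) → v f z = 0 := fun f z hz => Function.extend_apply' _ _ z hz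
  have hvinj : Function.Injective v := by
    intro f f' h
    funext u
    refine pairWord_injective g r ?_
    funext y s
    have h1 := congrFun h (p ((u, y), s))
    rw [hv1, hv1] at h1
    exact (div_left_inj' (hwp _)).1 h1
  have hvw : ∀ f i, w i ⬝ᵥ v f = 0 := by
    intro f i
    have h1 : ∑ x, w i (p x) * v f (p x) = w i ⬝ᵥ v f := by
      refine Finset.sum_of_injOn p hp.injOn (fun _ _ => Finset.mem_coe.2 (Finset.mem_univ _))
        (fun z _ hz => ?_) fun _ _ => rfl
      rw [hv0 f z fun ⟨x, hx⟩ => hz ⟨x, Finset.mem_coe.2 (Finset.mem_univ _), hx⟩, mul_zero]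
    rw [← h1, Fintype.sum_prod_type]
    refine Finset.sum_eq_zero fun u _ => ?_
    by_cases hi : i = φ u
    · subst hi
      rw [← pairWord_sum (f u.1) u.2]
      refine Finset.sum_congr rfl fun s _ => ?_
      rw [hv1]
      exact mul_div_cancel₀ _ (hwp (u, s))
    · exact Finset.sum_eq_zero fun s _ => by rw [hwp' i (u, s) hi, zero_mul]
  have hvs : ∀ f f', hammingNorm (v f - v f') ≤ 4 * t := by
    intro f f'
    refine le_trans ?_ (hammingNorm_pairWord_family_le f f')
    refine le_trans (Finset.card_le_card fun z hz => ?_) (Finset.card_image_le (f := p))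
    have hz' : v f z - v f' z ≠ 0 := (Finset.mem_filter.1 hz).2
    by_cases hx : ∃ x, p x = z
    · obtain ⟨x, rfl⟩ := hx
      refine Finset.mem_image_of_mem p (Finset.mem_filter.2 ⟨Finset.mem_univ _, fun h0 => hz' ?_⟩)
      rw [hv1, hv1, ← sub_div, h0, zero_div]
    · rw [hv0 f z hx, hv0 f' z hx, sub_zero] at hz'
      exact absurd rfl hz'
  let U : Finset (Fin n) := Finset.univ.image fun x : Fin j × Fin (r + 1) => pos x.1 x.2
  have hU : U.card ≤ j * (r + 1) := by
    refine Finset.card_image_le.trans ?_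
    simp
  have hUmem : ∀ i s, pos i s ∈ U := fun i s =>
    Finset.mem_image_of_mem (fun x : Fin j × Fin (r + 1) => pos x.1 x.2) (Finset.mem_univ (i, s))
  -- At least `n - j(r+1) = d - 2 - (rj - k)` coordinates are free, and `rj - k ≤ 4t - 1` makes this
  -- suffice.
  obtain ⟨B, hBU, hB⟩ := Finset.exists_subset_card_eq (s := Uᶜ) (n := d - 1 - 4 * t) (by
    rw [Finset.card_compl, Fintype.card_fin]
    have : j * (r + 1) = r * j + j := by ring
    omega)
  have hBw : ∀ i, ∀ z ∈ B, w i z = 0 := by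
    intro i z hz
    by_contra h
    obtain ⟨s, rfl⟩ := (hpos _ _).1 h
    exact Finset.mem_compl.1 (hBU hz) (hUmem i s)
  have hvB : ∀ f, ∀ z ∈ B, v f z = 0 := by
    intro f z hz
    refine hv0 f z ?_
    rintro ⟨x, rfl⟩
    exact Finset.mem_compl.1 (hBU hz) (hUmem _ _)
  have hρ : ∀ i i', w i (pos i' 0) ≠ 0 ↔ i = i' := by
    intro i i'
    rw [hpos]
    constructor
    · rintro ⟨s, hs⟩
      exact (hinj _ _ _ _ hs).1
    · rintro rfl
      exact ⟨0, rfl⟩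
  have h := card_mul_le_pow hd hρ hw hBw hvinj hvw hvB hvs (by omega)
  rw [hk, Fintype.card_fin, Fintype.card_fun, Fintype.card_fin] at h
  have hq : 0 < Fintype.card F := Fintype.card_pos
  have hkn : 4 * t ≤ n + 1 := by omega
  refine Nat.le_of_mul_le_mul_right (c := Fintype.card F ^ (n - (4 * t - 1))) ?_ (by positivity)
  have e1 : k + B.card + j = n - (4 * t - 1) := by omega
  rw [e1] at h
  have e2 : 4 * t + (n - (4 * t - 1)) = n + 1 := by omega
  rw [← pow_add, e2, pow_succ]
  calc _ = _ * Fintype.card F := by ring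
    _ ≤ _ := Nat.mul_le_mul_right _ h

lemma exists_enumeration {C : Submodule F (Fin n → F)} {r j : ℕ}
    {P : Finpartition (Finset.univ : Finset (Fin n))}
    (hP : ∀ I ∈ P.parts, I ∈ recoverySupports C r) (hr : ∀ I ∈ P.parts, I.card = r + 1)
    (hjl : j ≤ P.parts.card) :
    ∃ (w : Fin j → Fin n → F) (pos : Fin j → Fin (r + 1) → Fin n), (∀ i, w i ∈ dualCode C) ∧
      (∀ i z, w i z ≠ 0 ↔ ∃ s, pos i s = z) ∧
      ∀ i s i' s', pos i s = pos i' s' → i = i' ∧ s = s' := by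
  let I : Fin j → Finset (Fin n) := fun i => P.parts.equivFin.symm (i.castLE hjl)
  have hI : ∀ i, I i ∈ P.parts := fun i => (P.parts.equivFin.symm (i.castLE hjl)).2
  have hIinj : Function.Injective I := fun i i' h =>
    Fin.castLE_injective hjl (P.parts.equivFin.symm.injective (Subtype.ext h))
  choose w hw hsupp _ using fun i => hP (I i) (hI i)
  refine ⟨w, fun i s => (I i).orderEmbOfFin (hr _ (hI i)) s, hw, fun i z => ?_, ?_⟩
  · have h1 : w i z ≠ 0 ↔ z ∈ I i := by rw [← hsupp i]; simp [supp]
    rw [h1, ← Finset.mem_coe, ← Finset.range_orderEmbOfFin (I i) (hr _ (hI i)), Set.mem_range]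
  · intro i s i' s' h
    replace h : (I i).orderEmbOfFin (hr _ (hI i)) s = (I i').orderEmbOfFin (hr _ (hI i')) s' := h
    have hi : i = i' := by
      by_contra hne
      refine Finset.disjoint_left.1 (P.disjoint (hI i) (hI i') (hIinj.ne hne))
        (Finset.orderEmbOfFin_mem (I i) (hr _ (hI i)) s) ?_
      rw [h]
      exact Finset.orderEmbOfFin_mem _ _ _
    subst hi
    exact ⟨rfl, ((I i).orderEmbOfFin (hr _ (hI i))).injective h⟩

end

/-! ### Numerical estimates and the congruence condition. -/

lemma le_rpow_of_pow_mul_le {N q t : ℕ} (hq : 0 < q) (ht : 1 ≤ t)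
    (h : N ^ t * q ≤ q ^ (4 * t)) : (N : ℝ) ≤ q * (q : ℝ) ^ (3 - 1 / (t : ℝ)) := by
  have hq' : (0 : ℝ) < q := by exact_mod_cast hq
  have ht' : (t : ℝ) ≠ 0 := by positivity
  have h1 : (q : ℝ) * (q : ℝ) ^ (3 - 1 / (t : ℝ)) = (q : ℝ) ^ (4 - 1 / (t : ℝ)) := by
    rw [← Real.rpow_one_add' hq'.le]
    · congr 1; ring
    · have : 1 / (t : ℝ) ≤ 1 := by
        rw [div_le_one (by positivity)]; exact_mod_cast ht
      linarith
  rw [h1]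
  refine le_of_pow_le_pow_left₀ (n := t) (by omega) (by positivity) ?_
  rw [← Real.rpow_mul_natCast hq'.le]
  have h2 : (4 - 1 / (t : ℝ)) * t = ((4 * t : ℕ) : ℝ) - 1 := by
    push_cast; field_simp
  rw [h2, Real.rpow_sub_one hq'.ne', Real.rpow_natCast, le_div_iff₀ hq']
  exact_mod_cast h

/-- The number of recovery sets is bounded by the packing bound. -/
lemma mul_succ_le_rpow {F : Type*} [Field F] [Fintype F] [DecidableEq F] {j r t : ℕ} (ht : 1 ≤ t)
    (htr : 4 * t ≤ r) (hrj : r ≤ j)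
    (h : Fintype.card (PairIndex F (j / t) r) ^ t * Fintype.card F ≤ Fintype.card F ^ (4 * t)) :
    (j * (r + 1) : ℝ) ≤ 2 * (Fintype.card F : ℝ) ^ (3 - 1 / (t : ℝ)) := by
  have hq : 2 ≤ Fintype.card F := Fintype.one_lt_card
  have h1 := le_rpow_of_pow_mul_le (by omega) ht h
  have h2 := card_pairIndex (F := F) (j / t) r
  set N := Fintype.card (PairIndex F (j / t) r)
  set q := Fintype.card F
  have hg : 1 ≤ j / t := (Nat.one_le_div_iff ht).2 (by omega)
  have hjt : j ≤ 2 * t * (j / t) := by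
    have := Nat.lt_mul_div_succ j ht
    nlinarith
  have h3 : j * (r + 1) * q ≤ 2 * N := by
    rw [h2]
    -- The factor `4t` from rounding `j / t` and from `q ≤ 2(q - 1)` is absorbed by one factor `r`.
    calc j * (r + 1) * q ≤ (2 * t * (j / t)) * (r + 1) * (2 * (q - 1)) := by
          gcongr; omega
      _ = (4 * t) * (j / t) * (r + 1) * (q - 1) := by ring
      _ ≤ r * (j / t) * (r + 1) * (q - 1) := by gcongr
      _ = _ := by ring
  have h4 : (j * (r + 1) * q : ℝ) ≤ 2 * N := by exact_mod_cast h3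
  have hq' : (0 : ℝ) < q := by positivity
  refine le_of_mul_le_mul_right ?_ hq'
  linarith

/-- For an optimal code with disjoint recovery sets, `⌈k / r⌉ = j` satisfies `r j - k < 4 t` when
`d` is congruent to one of `4 t - 2, …, 4 t + 1` modulo `r + 1`. -/
lemma exists_ceil_eq {n k d r t : ℕ} {i : ℤ}
    (hs : (d : ℤ) = (n : ℤ) - (k : ℤ) - ⌈(k : ℚ) / (r : ℚ)⌉ + 2) (hn : (r + 1) ∣ n)
    (ht : 1 ≤ t) (htr : 4 * t ≤ r) (hi : i = -1 ∨ i = 0 ∨ i = 1 ∨ i = 2)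
    (hmod : (d : ℤ) ≡ 4 * (t : ℤ) - i [ZMOD ((r : ℤ) + 1)]) :
    ∃ j : ℕ, d + k + j = n + 2 ∧ k ≤ r * j ∧ r * j < k + r ∧ r * j + 1 ≤ k + 4 * t := by
  have hr : (0 : ℚ) < r := by
    have : 0 < r := by omega
    exact_mod_cast this
  have h0 : 0 ≤ ⌈(k : ℚ) / (r : ℚ)⌉ := Int.ceil_nonneg (by positivity)
  obtain ⟨j, hj⟩ := Int.eq_ofNat_of_zero_le h0
  have h1 := Int.le_ceil ((k : ℚ) / r)
  have h2 := Int.ceil_lt_add_one ((k : ℚ) / r)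
  rw [hj] at hs h1 h2
  have h1' : k ≤ r * j := by
    rw [div_le_iff₀ hr] at h1
    rw [mul_comm]; exact_mod_cast h1
  have h2' : r * j < k + r := by
    rw [← sub_lt_iff_lt_add, lt_div_iff₀ hr] at h2
    have h3 : (r * j : ℚ) < k + r := by
      push_cast at h2
      linarith
    exact_mod_cast h3
  refine ⟨j, by omega, h1', h2', ?_⟩
  obtain ⟨m, rfl⟩ := hn
  obtain ⟨e, he⟩ := Nat.exists_eq_add_of_le h1'
  have he' : e < r := by omega
  obtain ⟨y, hy⟩ := hmod.dvd
  -- Since `r + 1` divides `n`, optimality gives `d ≡ e + 2`; both sides are too small to differ by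
  -- a nonzero multiple, so `e = 4t - i - 2 ≤ 4t - 1`.
  have hey : ((e : ℤ) + 2 - (4 * t - i)) = (r + 1) * (j - m - y) := by
    have : (r * j : ℤ) = k + e := by exact_mod_cast he
    push_cast at hs
    linear_combination -hy - hs - this
  have hz : (j - m - y : ℤ) = 0 := by
    have hlt : |(e : ℤ) + 2 - (4 * t - i)| < (r : ℤ) + 1 := by
      rw [abs_lt]; constructor <;> omega
    exact by_contra fun hne => by
      rw [hey, abs_mul] at hlt
      have := Int.one_le_abs hne
      have h4 : |(r : ℤ) + 1| = r + 1 := abs_of_nonneg (by omega)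
      rw [h4] at hlt
      nlinarith
  rw [hz, mul_zero] at hey
  omega

end LRC

/-! ### Assembly of the bound. -/

theorem mainTheorem10 :
    ∀ c : ℝ, 0 < c → ∃ K : ℝ, 0 < K ∧
      ∀ (F : Type*) [Field F] [Fintype F] [DecidableEq F]
        (n k d r t : ℕ) (i : ℤ) (C : Submodule F (Fin n → F)),
        LRC.IsSingletonOptimal C k d r →
        LRC.HasDisjointRecoverySets C r →
        (r + 1) ∣ n →
        r < k →
        r + 2 ≤ d →
        c * ((d : ℝ) * (r : ℝ) ^ 2) ≤ (n : ℝ) →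
        1 ≤ t →
        (t : ℝ) ≤ (r : ℝ) / 4 →
        (i = -1 ∨ i = 0 ∨ i = 1 ∨ i = 2) →
        (d : ℤ) ≡ 4 * (t : ℤ) - i [ZMOD ((r : ℤ) + 1)] →
        (n : ℝ) ≤ K * (Fintype.card F : ℝ) ^ (3 - 1 / (t : ℝ)) := by
  intro c hc
  -- `2 + 2` comes from `d` and `j(r+1)` when `j ≥ r`; `8 / c²` bounds `2r²` when `j < r`.
  refine ⟨4 + 8 / c ^ 2, by positivity, ?_⟩
  intro F _ _ _ n k d r t i C hC ⟨P, hP⟩ hn hrk hd hcn ht htr hi hmod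
  have htr' : 4 * t ≤ r := by
    rw [le_div_iff₀ (by norm_num)] at htr
    have : (t * 4 : ℝ) = ((4 * t : ℕ) : ℝ) := by push_cast; ring
    rw [this] at htr
    exact_mod_cast htr
  obtain ⟨j, hj, hkj, hjk, hjk4⟩ := LRC.exists_ceil_eq hC.singleton_eq hn ht htr' hi hmod
  have hmin := hC.minDist
  have hj2 : 2 ≤ j := by
    by_contra! h
    have : r * j ≤ r * 1 := Nat.mul_le_mul_left r (by omega)
    omega
  have hjl : j ≤ P.parts.card := by
    have h1 := LRC.card_le_parts_mul hP
    refine Nat.le_of_mul_le_mul_right (c := r + 1) ?_ (by omega)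
    have : j * (r + 1) = r * j + j := by ring
    omega
  have hdq : d ≤ 2 * Fintype.card F :=
    LRC.minDist_le_two_mul_card hC.dim_eq hmin hP hj hjk (by omega) hj2 (by omega) hjl
  set E : ℝ := (Fintype.card F : ℝ) ^ (3 - 1 / (t : ℝ)) with hE
  have hq1 : (1 : ℝ) ≤ Fintype.card F := by exact_mod_cast Fintype.card_pos (α := F)
  have hqE : (Fintype.card F : ℝ) ≤ E := by
    refine Real.self_le_rpow_of_one_le hq1 ?_
    have : 1 / (t : ℝ) ≤ 1 := by
      rw [div_le_one (by exact_mod_cast ht)]; exact_mod_cast ht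
    linarith
  have hdE : (d : ℝ) ≤ 2 * E := by
    have : (d : ℝ) ≤ 2 * Fintype.card F := by exact_mod_cast hdq
    linarith
  have hnd : (n : ℝ) ≤ d + j * (r + 1) := by
    have : n ≤ d + j * (r + 1) := by
      have : j * (r + 1) = r * j + j := by ring
      omega
    exact_mod_cast this
  have hK : 0 ≤ 8 / c ^ 2 := by positivity
  rcases le_or_gt r j with hrj | hjr
  · have hcard := LRC.card_part_eq hC.dim_eq hmin hP hn hj hjk hrj (by omega) (by omega) hjl
    obtain ⟨w, pos, hw, hpos, hinj⟩ := LRC.exists_enumeration hP hcard hjl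
    have h1 := LRC.mul_succ_le_rpow ht htr' hrj (LRC.card_pairIndex_pow_le hC.dim_eq hmin hj hw
      hpos hinj ht (by omega) hjk4 (Nat.mul_div_le j t))
    nlinarith
  · have hr0 : (4 : ℝ) ≤ r := by
      have : 4 ≤ r := by omega
      exact_mod_cast this
    have hjr' : (j : ℝ) ≤ r := by exact_mod_cast hjr.le
    have hd' : (r : ℝ) + 2 ≤ d := by exact_mod_cast hd
    have hjr2 : (j * (r + 1) : ℝ) ≤ r * d := by
      apply mul_le_mul <;> linarith
    -- Here `c d r² ≤ n ≤ d + rd ≤ 2rd`, so `r ≤ 2/c`.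
    have h1 : (r * d : ℝ) * (c * r) ≤ (r * d) * 2 := by nlinarith
    have h2 : c * r ≤ 2 := le_of_mul_le_mul_left h1 (mul_pos (by linarith) (by linarith))
    have h3 : (r : ℝ) ^ 2 ≤ 4 / c ^ 2 := by
      rw [le_div_iff₀ (by positivity)]
      have : 0 ≤ c * r := by positivity
      nlinarith
    have h4 : (j * (r + 1) : ℝ) ≤ 2 * r ^ 2 := by nlinarith
    have h5 : 8 / c ^ 2 = 2 * (4 / c ^ 2) := by ring
    have h6 : 8 / c ^ 2 ≤ 8 / c ^ 2 * E := le_mul_of_one_le_right hK (hq1.trans hqE)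
    nlinarith
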